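/- Let $(X,d)$ be a locally compact separable metric space with a Radon measure $\mu$ that is volume doubling: there is $C<\infty$ with $\mu(B(x,2r))\le C\,\mu(B(x,r))$ for all $x\in X$, $r>0$, where $B(x,r)=\{y: d(x,y)<r\}$. Fix a point $o\in X$. A weight is a measurable function $w:X\to(0,\infty)$ for which $d\mu_w=w\,d\mu$ is a Radon measure. For $1\le p<\infty$ let $L^p_w$ be $L^p(X,\mu_w)$, let weak $L^p_w$ be the set of measurable $g$ with $\|g\|_{L^{p,\infty}_w}=\sup_{\lambda>0}\lambda\,\mu_w(\{|g|>\lambda\})^{1/p}<\infty$, let $\frac1p+\frac1{p'}=1$, and write $g\in L^{q}_{\mathrm{loc}}$ if $g\chi_{B(o,r)}\in L^{q}(X,\mu)$ for every $r>0$. For measurable $f:X\to\mathbb R$ and $R>0$ put $$A_Rf(x)=\frac1{\mu(B(x,R))}\int_{B(x,R)}|f|\,d\mu\in[0,\infty],\qquad M_Rf(x)=\sup_{0<r<R}A_rf(x).$$ Let $1\le p<\infty$, let $v$ be a weight and let $R>0$. (1) If $v^{-1/p}\in L^{p'}_{\mathrm{loc}}$, then there is a weight $u$ such that $M_R$ maps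 $L^p_v$ boundedly into $L^p_u$ if $p>1$, and maps $L^1_v$ boundedly into weak $L^1_u$ if $p=1$; that is, there is $C<\infty$ such that for all $f\in L^p_v$ the function $M_Rf$ is in the target space and $\|M_Rf\|_{L^p_u}\le C\|f\|_{L^p_v}$, respectively $\|M_Rf\|_{L^{1,\infty}_u}\le C\|f\|_{L^1_v}$. (2) Conversely, if $\mu_v(B(o,r))<\infty$ for all $r>0$ and there is a weight $u$ such that $A_Rf$ lies in weak $L^p_u$ for every $f\in L^p_v$, then $v^{-1/p}\in L^{p'}_{\mathrm{loc}}$. -/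

import Mathlib

open MeasureTheory Set Metric
open scoped ENNReal NNReal

namespace TwoWeight

noncomputable section

/-- Volume doubling: there is a finite constant `C` such that
`μ (B(x, 2r)) ≤ C μ (B(x, r))` for all open balls. -/
def VolumeDoubling {X : Type*} [MetricSpace X] [MeasurableSpace X] (μ : Measure X) : Prop :=
  ∃ C : ℝ≥0, ∀ (x : X) (r : ℝ), 0 < r → μ (ball x (2 * r)) ≤ C * μ (ball x r)

/-- The measure `μ_w`, with `dμ_w = w dμ`. -/
def weighted {X : Type*} [MeasurableSpace X] (μ : Measure X) (w : X → ℝ) : Measure X :=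
  μ.withDensity fun x => ENNReal.ofReal (w x)

/-- A weight: a measurable, strictly positive function `w` such that `w dμ` is a Radon measure
(finite on compact sets, outer regular, and inner regular by compact sets on open sets). -/
structure IsWeight {X : Type*} [MetricSpace X] [MeasurableSpace X]
    (μ : Measure X) (w : X → ℝ) : Prop where
  measurable : Measurable w
  pos : ∀ x, 0 < w x
  radon : (weighted μ w).Regular

/-- `g ∈ L^q_loc`: the product of `g` with the indicator of every ball about the fixed base
point `o` is in `L^q`. -/
def MemLpLoc {X : Type*} [MetricSpace X] [MeasurableSpace X]
    (μ : Measure X) (o : X) (q : ℝ≥0∞) (g : X → ℝ) : Prop :=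
  ∀ r : ℝ, 0 < r → MemLp ((ball o r).indicator g) q μ

/-- The averaging operator `A_r f (x) = μ(B(x,r))⁻¹ ∫_{B(x,r)} |f| dμ`, with values
in `[0, ∞]`. -/
def averaging {X : Type*} [MetricSpace X] [MeasurableSpace X]
    (μ : Measure X) (r : ℝ) (f : X → ℝ) (x : X) : ℝ≥0∞ :=
  (μ (ball x r))⁻¹ * ∫⁻ y in ball x r, ‖f y‖ₑ ∂μ

/-- The local Hardy-Littlewood maximal operator `M_R f (x) = sup_{0 < r < R} A_r f (x)`. -/
def localMaximal {X : Type*} [MetricSpace X] [MeasurableSpace X]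
    (μ : Measure X) (R : ℝ) (f : X → ℝ) (x : X) : ℝ≥0∞ :=
  ⨆ r ∈ Ioo (0 : ℝ) R, averaging μ r f x

/-- The weak `L^p` quasinorm `sup_{t > 0} t ν{g > t}^{1/p}` of a `[0, ∞]`-valued function. -/
def weakNorm {X : Type*} [MeasurableSpace X] (g : X → ℝ≥0∞) (p : ℝ) (ν : Measure X) : ℝ≥0∞ :=
  ⨆ (t : ℝ≥0) (_ : 0 < t), (t : ℝ≥0∞) * ν {x | (t : ℝ≥0∞) < g x} ^ (1 / p)

/-- Membership in weak `L^p(ν)`. -/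
def MemWeakLp {X : Type*} [MeasurableSpace X] (g : X → ℝ≥0∞) (p : ℝ) (ν : Measure X) : Prop :=
  AEMeasurable g ν ∧ weakNorm g p ν < ∞

/-- `T` maps `L^p(ν)` boundedly into `L^p(ν')`. -/
def BoundedIntoLp {X : Type*} [MeasurableSpace X] (T : (X → ℝ) → X → ℝ≥0∞) (p : ℝ)
    (ν ν' : Measure X) : Prop :=
  ∃ C : ℝ≥0, ∀ f : X → ℝ, MemLp f (ENNReal.ofReal p) ν →
    MemLp (T f) (ENNReal.ofReal p) ν' ∧
      eLpNorm (T f) (ENNReal.ofReal p) ν' ≤ C * eLpNorm f (ENNReal.ofReal p) ν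

/-- `T` maps `L^p(ν)` boundedly into weak `L^p(ν')`. -/
def BoundedIntoWeakLp {X : Type*} [MeasurableSpace X] (T : (X → ℝ) → X → ℝ≥0∞) (p : ℝ)
    (ν ν' : Measure X) : Prop :=
  ∃ C : ℝ≥0, ∀ f : X → ℝ, MemLp f (ENNReal.ofReal p) ν →
    MemWeakLp (T f) p ν' ∧ weakNorm (T f) p ν' ≤ C * eLpNorm f (ENNReal.ofReal p) ν

/-- `T` maps `L^p(ν)` into weak `L^p(ν')`; no bound on the quasinorm is required. -/
def MapsIntoWeakLp {X : Type*} [MeasurableSpace X] (T : (X → ℝ) → X → ℝ≥0∞) (p : ℝ)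
    (ν ν' : Measure X) : Prop :=
  ∀ f : X → ℝ, MemLp f (ENNReal.ofReal p) ν → MemWeakLp (T f) p ν'

end

end TwoWeight

namespace TwoWeight

/-! ### Balls under a doubling measure: covering, measurability, total boundedness -/

section Balls

variable {X : Type*} [MetricSpace X] [MeasurableSpace X]

/-! Sufficiency, `1 < p`. Let `σ = v ^ (-1/(p-1))` be the dual weight and `S = σ dμ`, which the
hypothesis makes finite on balls. Writing `|f| = g σ`, factor `A_r f(x)` as `S(B(x,8r)) / μ(B(x,r))`
times `S(B(x,8r))⁻¹ ∫_{B(x,r)} g dS`. Hence `M_R f ≤ K · T g`, where `K` does not depend on `f` and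
is finite almost everywhere (`VolumeDoubling.ae_iSup_lt_top`). The operator `T` is bounded on
`L^p(S)` although `S` need not be doubling, since the dilated denominator is exactly what a Vitali
covering asks for (`lintegral_modifiedMaximal_rpow_le`). As `∫ g^p dS = ∫ |f|^p v dμ`, the weight `u
= min(1, σ K^(-p))` works.

Sufficiency, `p = 1`. Here `v⁻¹` is locally essentially bounded; `u(y)` is the reciprocal of a bound
on a ball large enough to contain every ball that the covering argument can pair with `y`. Both
cases rest on `measure_le_of_ball_le_ball`.

Necessity. If `v ^ (-1/p)` is not in `L^{p'}` on some ball `B` of radius `R/2`, a gliding hump gives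
`f ∈ L^p_v` with `∫_B |f| dμ = ∞`. Every ball of radius `R` centred in `B` contains `B`, so `A_R f =
∞` on `B`, a set of positive `μ_u`-measure, which weak `L^p_u` forbids. Finitely many balls of
radius `R/2` cover any given ball, by doubling. -/

theorem exists_lt_measure_ball (ν : Measure X) {x : X} {r : ℝ} {c : ℝ≥0∞} (h : c < ν (ball x r)) :
    ∃ s < r, c < ν (ball x s) := by
  have hU : ball x r = ⋃ n : ℕ, ball x (r - 1 / ((n : ℝ) + 1)) := by
    ext y
    simp only [mem_ball, mem_iUnion]
    constructor
    · intro hy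
      obtain ⟨n, hn⟩ := exists_nat_one_div_lt (sub_pos.2 hy)
      exact ⟨n, by linarith⟩
    · rintro ⟨n, hn⟩
      have : (0 : ℝ) < 1 / ((n : ℝ) + 1) := by positivity
      linarith
  have hm : Monotone fun n : ℕ => ball x (r - 1 / ((n : ℝ) + 1)) := by
    intro m n hmn
    apply ball_subset_ball
    have := one_div_le_one_div_of_le (by positivity : (0 : ℝ) < (m : ℝ) + 1)
      (by gcongr : (m : ℝ) + 1 ≤ (n : ℝ) + 1)
    linarith
  rw [hU, hm.measure_iUnion, lt_iSup_iff] at h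
  obtain ⟨n, hn⟩ := h
  exact ⟨_, sub_lt_self r (by positivity), hn⟩

theorem VolumeDoubling.pow {μ : Measure X} (h : VolumeDoubling μ) :
    ∃ C : ℝ≥0, ∀ (n : ℕ) (x : X) (r : ℝ), 0 < r →
      μ (ball x (2 ^ n * r)) ≤ (C : ℝ≥0∞) ^ n * μ (ball x r) := by
  obtain ⟨C, hC⟩ := h
  refine ⟨C, fun n x r hr => ?_⟩
  induction n with
  | zero => simp
  | succ n ih =>
    calc μ (ball x (2 ^ (n + 1) * r)) = μ (ball x (2 * (2 ^ n * r))) := by congr 2; ring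
      _ ≤ C * μ (ball x (2 ^ n * r)) := hC x _ (by positivity)
      _ ≤ C * ((C : ℝ≥0∞) ^ n * μ (ball x r)) := by gcongr
      _ = (C : ℝ≥0∞) ^ (n + 1) * μ (ball x r) := by ring

/-- A slightly smaller concentric ball still has mass above `c`, and it lies in `B(y, r)` for all
`y` near `x`. -/
theorem lowerSemicontinuous_measure_ball (ν : Measure X) (r : ℝ) :
    LowerSemicontinuous fun x => ν (ball x r) := by
  intro x c hc
  obtain ⟨s, hs, hcs⟩ := exists_lt_measure_ball ν hc
  filter_upwards [ball_mem_nhds x (sub_pos.2 hs)] with y hy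
  refine hcs.trans_le (measure_mono (ball_subset_ball' ?_))
  rw [mem_ball, dist_comm] at hy
  linarith

theorem VolumeDoubling.measure_ball_lt_top {μ : Measure X} [IsLocallyFiniteMeasure μ]
    (h : VolumeDoubling μ) (x : X) (r : ℝ) : μ (ball x r) < ∞ := by
  obtain ⟨C, hC⟩ := h.pow
  obtain ⟨U, hU, hUfin⟩ := μ.finiteAt_nhds x
  obtain ⟨s, hs, hsU⟩ := Metric.mem_nhds_iff.1 hU
  obtain ⟨n, hn⟩ := pow_unbounded_of_one_lt (r / s) (one_lt_two : (1 : ℝ) < 2)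
  calc μ (ball x r) ≤ μ (ball x (2 ^ n * s)) :=
        measure_mono (ball_subset_ball ((div_lt_iff₀ hs).1 hn).le)
    _ ≤ (C : ℝ≥0∞) ^ n * μ (ball x s) := hC n x s hs
    _ < ∞ := ENNReal.mul_lt_top (ENNReal.pow_lt_top ENNReal.coe_lt_top)
        ((measure_mono hsU).trans_lt hUfin)

theorem VolumeDoubling.measure_ball_pos {μ : Measure X} (h : VolumeDoubling μ) (hμ : μ ≠ 0)
    (x : X) {r : ℝ} (hr : 0 < r) : 0 < μ (ball x r) := by
  obtain ⟨C, hC⟩ := h.pow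
  rw [pos_iff_ne_zero]
  intro h0
  apply hμ
  rw [← Measure.measure_univ_eq_zero]
  have hU : (univ : Set X) = ⋃ n : ℕ, ball x (2 ^ n * r) := by
    refine (eq_univ_of_forall fun y => mem_iUnion.2 ?_).symm
    obtain ⟨n, hn⟩ := pow_unbounded_of_one_lt (dist y x / r) (one_lt_two : (1 : ℝ) < 2)
    exact ⟨n, (div_lt_iff₀ hr).1 hn⟩
  rw [hU, measure_iUnion_null_iff]
  intro n
  simpa [h0] using hC n x r hr

variable [BorelSpace X]

/-- A weak type covering estimate: the Vitali covering lemma compares two measures on a set each of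
whose points is the centre of a ball on which the measures are comparable. -/
theorem measure_le_of_ball_le_ball [TopologicalSpace.SeparableSpace X] (ν₁ ν₂ : Measure X)
    (R : ℝ) (E : Set X)
    (h : ∀ x ∈ E, ∃ r ∈ Ioo (0 : ℝ) R, ν₁ (ball x (8 * r)) ≤ ν₂ (ball x r)) :
    ν₁ E ≤ ν₂ univ := by
  choose! r hr hle using h
  -- The enlargement factor `8 = 2 ^ 3` makes each enlargement cost three doublings.
  obtain ⟨u, huE, hdisj, hcov⟩ :=
    Vitali.exists_disjoint_subfamily_covering_enlargement_ball E id r R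
      (fun a ha => (hr a ha).2.le) 8 (by norm_num)
  have hcount : u.Countable := hdisj.countable_of_isOpen (fun _ _ => isOpen_ball)
    (fun x hx => nonempty_ball.2 (hr x (huE hx)).1)
  calc ν₁ E ≤ ν₁ (⋃ x ∈ u, ball x (8 * r x)) := by
        refine measure_mono fun a ha => ?_
        obtain ⟨b, hb, hab⟩ := hcov a ha
        exact mem_biUnion hb (hab (mem_ball_self (hr a ha).1))
    _ ≤ ∑' x : u, ν₁ (ball x (8 * r x)) := measure_biUnion_le ν₁ hcount _
    _ ≤ ∑' x : u, ν₂ (ball x (r x)) := ENNReal.tsum_le_tsum fun x => hle x (huE x.2)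
    _ = ν₂ (⋃ x ∈ u, ball x (r x)) :=
        (measure_biUnion hcount hdisj (fun _ _ => measurableSet_ball)).symm
    _ ≤ ν₂ univ := measure_mono (subset_univ _)

theorem measurable_measure_ball (ν : Measure X) (r : ℝ) :
    Measurable fun x => ν (ball x r) :=
  (lowerSemicontinuous_measure_ball ν r).measurable

/-- Maximal functions formed with quotients of measures of concentric balls are measurable. -/
theorem measurable_iSup_inv_measure_ball_mul (ν₁ ν₂ : Measure X) {a b : ℝ} (ha : 0 < a)
    (hb : 0 < b) (R : ℝ) :
    Measurable fun x => ⨆ r ∈ Ioo (0 : ℝ) R, (ν₁ (ball x (a * r)))⁻¹ * ν₂ (ball x (b * r)) := by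
  have key : (fun x => ⨆ r ∈ Ioo (0 : ℝ) R, (ν₁ (ball x (a * r)))⁻¹ * ν₂ (ball x (b * r))) =
      fun x => ⨆ q : ℚ, ⨆ _ : (q : ℝ) ∈ Ioo (0 : ℝ) R,
        (ν₁ (ball x (a * q)))⁻¹ * ν₂ (ball x (b * q)) := by
    funext x
    apply le_antisymm
    · refine iSup₂_le fun r hr => le_of_forall_lt fun c hc => ?_
      -- With the first factor frozen, the quotient is a measure of `B(x, br)`, hence is
      -- approximated from inside; lowering `r` to a rational `q` only increases the inverse factor.
      rw [← smul_eq_mul, ← Measure.smul_apply] at hc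
      obtain ⟨s, hs, hcs⟩ := exists_lt_measure_ball _ hc
      obtain ⟨q, hq, hqr⟩ := exists_rat_btwn (max_lt ((div_lt_iff₀' hb).2 hs) hr.1)
      refine hcs.trans_le (le_trans ?_
        (le_iSup₂ (f := fun (q : ℚ) (_ : (q : ℝ) ∈ Ioo (0 : ℝ) R) =>
          (ν₁ (ball x (a * q)))⁻¹ * ν₂ (ball x (b * q))) q
          ⟨(le_max_right _ _).trans_lt hq, hqr.trans hr.2⟩))
      rw [Measure.smul_apply, smul_eq_mul]
      have h1 : a * (q : ℝ) ≤ a * r := by gcongr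
      have h2 : s ≤ b * (q : ℝ) := by
        have := (le_max_left (s / b) 0).trans hq.le
        rwa [div_le_iff₀' hb] at this
      gcongr
    · exact iSup₂_le fun q hq => le_iSup₂
        (f := fun (r : ℝ) (_ : r ∈ Ioo (0 : ℝ) R) =>
          (ν₁ (ball x (a * r)))⁻¹ * ν₂ (ball x (b * r))) (q : ℝ) hq
  rw [key]
  exact Measurable.iSup fun q => Measurable.iSup fun _ =>
    (measurable_measure_ball ν₁ _).inv.mul (measurable_measure_ball ν₂ _)

theorem measurable_localMaximal (μ : Measure X) (R : ℝ) (f : X → ℝ) :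
    Measurable (localMaximal μ R f) := by
  have h := measurable_iSup_inv_measure_ball_mul μ (μ.withDensity fun y => ‖f y‖ₑ) one_pos
    one_pos R
  have e : localMaximal μ R f = fun x => ⨆ r ∈ Ioo (0 : ℝ) R, (μ (ball x (1 * r)))⁻¹ *
      μ.withDensity (fun y => ‖f y‖ₑ) (ball x (1 * r)) := by
    funext x
    simp only [localMaximal, averaging, one_mul, withDensity_apply _ measurableSet_ball]
  rw [e]
  exact h

/-- The modified maximal quotient of a measure finite on balls is finite almost everywhere. -/
theorem VolumeDoubling.ae_iSup_lt_top [TopologicalSpace.SeparableSpace X] {μ : Measure X}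
    (h : VolumeDoubling μ) (S : Measure X) (o : X) (hS : ∀ r : ℝ, S (ball o r) < ∞) (R : ℝ) :
    ∀ᵐ x ∂μ, (⨆ r ∈ Ioo (0 : ℝ) R, (μ (ball x r))⁻¹ * S (ball x (8 * r))) < ∞ := by
  obtain ⟨C, hC⟩ := h.pow
  set K : X → ℝ≥0∞ := fun x => ⨆ r ∈ Ioo (0 : ℝ) R, (μ (ball x r))⁻¹ * S (ball x (8 * r)) with hK
  have hnull : ∀ k : ℕ, μ (ball o k ∩ {x | K x = ∞}) = 0 := by
    intro k
    by_contra hne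
    have hfin : (C : ℝ≥0∞) ^ 6 * S (ball o (k + 8 * R)) ≠ ∞ :=
      (ENNReal.mul_lt_top (ENNReal.pow_lt_top ENNReal.coe_lt_top) (hS _)).ne
    obtain ⟨n, hn⟩ := ENNReal.exists_nat_mul_gt hne hfin
    refine hn.not_ge ?_
    have := measure_le_of_ball_le_ball ((n : ℝ≥0∞) • μ)
      ((C : ℝ≥0∞) ^ 6 • S.restrict (ball o (k + 8 * R))) (8 * R) (ball o k ∩ {x | K x = ∞}) ?_
    · simpa using this
    rintro x ⟨hxk, hx⟩
    have hlt : (n : ℝ≥0∞) < K x := by rw [show K x = ∞ from hx]; exact ENNReal.natCast_lt_top n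
    simp only [hK, lt_iSup_iff] at hlt
    obtain ⟨r, hr, hlt⟩ := hlt
    -- Vitali is applied to the balls of radius `8r` seen by `S`; their enlargements have radius
    -- `64r = 2 ^ 6 * r`, whence `C ^ 6`. The resulting bound on `n * μ(E)` is independent of `n`.
    refine ⟨8 * r, ⟨by linarith [hr.1], by linarith [hr.2]⟩, ?_⟩
    have hsub : ball x (8 * r) ⊆ ball o (k + 8 * R) := by
      apply ball_subset_ball'
      rw [mem_ball] at hxk
      linarith [hr.2]
    simp only [Measure.smul_apply, smul_eq_mul, Measure.restrict_apply measurableSet_ball,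
      inter_eq_left.2 hsub]
    calc (n : ℝ≥0∞) * μ (ball x (8 * (8 * r))) = n * μ (ball x (2 ^ 6 * r)) := by
          congr 3; ring
      _ ≤ n * ((C : ℝ≥0∞) ^ 6 * μ (ball x r)) := by gcongr; exact hC 6 x r hr.1
      _ = (C : ℝ≥0∞) ^ 6 * (μ (ball x r) * n) := by ring
      _ ≤ (C : ℝ≥0∞) ^ 6 * (μ (ball x r) * ((μ (ball x r))⁻¹ * S (ball x (8 * r)))) := by
          gcongr
      _ = (C : ℝ≥0∞) ^ 6 * ((μ (ball x r) * (μ (ball x r))⁻¹) * S (ball x (8 * r))) := by ring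
      _ ≤ (C : ℝ≥0∞) ^ 6 * (1 * S (ball x (8 * r))) := by
          gcongr; exact ENNReal.mul_inv_le_one _
      _ = _ := by rw [one_mul]
  have hU : {x | ¬ K x < ∞} ⊆ ⋃ k : ℕ, (ball o k ∩ {x | K x = ∞}) := by
    intro x hx
    obtain ⟨k, hk⟩ := exists_nat_gt (dist x o)
    exact mem_iUnion.2 ⟨k, hk, by simpa using hx⟩
  exact measure_mono_null hU (measure_iUnion_null_iff.2 hnull)

/-- In a space with a nonzero doubling measure, balls are totally bounded. -/
theorem VolumeDoubling.exists_finite_cover {μ : Measure X} [IsLocallyFiniteMeasure μ]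
    (h : VolumeDoubling μ) (hμ : μ ≠ 0) (o : X) (r : ℝ) {δ : ℝ} (hδ : 0 < δ) :
    ∃ t : Set X, t.Finite ∧ ball o r ⊆ ⋃ x ∈ t, ball x δ := by
  obtain ⟨C, hC⟩ := h.pow
  -- Disjoint balls of radius `δ / 8` centred in `B(o, r)` have masses bounded below by doubling and
  -- lie in one ball of finite mass, so they are finitely many; their enlargements have radius `δ`.
  obtain ⟨u, huE, hdisj, hcov⟩ :=
    Vitali.exists_disjoint_subfamily_covering_enlargement_ball (ball o r) id (fun _ => δ / 8)
      (δ / 8) (fun a ha => le_rfl) 8 (by norm_num)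
  refine ⟨u, ?_, fun x hx => ?_⟩
  · obtain ⟨n, hn⟩ := pow_unbounded_of_one_lt (2 * r / (δ / 8)) (one_lt_two : (1 : ℝ) < 2)
    rw [div_lt_iff₀ (by positivity)] at hn
    rcases le_or_gt r 0 with hr | hr
    · rw [ball_eq_empty.2 hr] at huE
      exact (subset_empty_iff.1 huE) ▸ finite_empty
    have hlow : ∀ x ∈ u, μ (ball o r) ≤ (C : ℝ≥0∞) ^ n * μ (ball x (δ / 8)) := fun x hx => by
      refine (measure_mono (ball_subset_ball' ?_)).trans (hC n x _ (by positivity))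
      have := huE hx
      rw [mem_ball, dist_comm] at this
      linarith
    have hpos : 0 < μ (ball o r) := h.measure_ball_pos hμ o hr
    have hε : 0 < ((C : ℝ≥0∞) ^ n)⁻¹ * μ (ball o r) :=
      ENNReal.mul_pos (ENNReal.inv_ne_zero.2 (ENNReal.pow_lt_top ENNReal.coe_lt_top).ne) hpos.ne'
    have := Measure.finite_const_le_meas_of_disjoint_iUnion μ hε
      (As := fun x : u => ball (x : X) (δ / 8)) (fun _ => measurableSet_ball)
      (fun x y hxy => hdisj x.2 y.2 (fun e => hxy (Subtype.ext e))) ?_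
    · have huniv : {i : u | ((C : ℝ≥0∞) ^ n)⁻¹ * μ (ball o r) ≤ μ (ball (i : X) (δ / 8))} =
          univ := eq_univ_of_forall fun i => by
        have h1 := hlow i i.2
        calc ((C : ℝ≥0∞) ^ n)⁻¹ * μ (ball o r)
            ≤ ((C : ℝ≥0∞) ^ n)⁻¹ * ((C : ℝ≥0∞) ^ n * μ (ball (i : X) (δ / 8))) := by gcongr
          _ = ((C : ℝ≥0∞) ^ n)⁻¹ * (C : ℝ≥0∞) ^ n * μ (ball (i : X) (δ / 8)) := by ring
          _ ≤ 1 * μ (ball (i : X) (δ / 8)) := by gcongr; exact ENNReal.inv_mul_le_one _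
          _ = _ := one_mul _
      rw [huniv] at this
      exact finite_coe_iff.1 (finite_univ_iff.1 this)
    · refine ((measure_mono (iUnion_subset fun x => ?_)).trans_lt
        (h.measure_ball_lt_top o (r + δ / 8))).ne
      apply ball_subset_ball'
      have := huE x.2
      rw [mem_ball] at this
      linarith
  · obtain ⟨b, hb, hab⟩ := hcov x hx
    refine mem_biUnion hb ?_
    have := hab (mem_ball_self (by positivity))
    simpa [mul_div_cancel₀] using this

end Balls

/-! ### Strong type bound for the modified maximal function -/

section StrongType

variable {X : Type*} [MetricSpace X] [MeasurableSpace X]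

/-- The modified maximal function with respect to `S`: averages of `g` over balls are normalised by
the measure of the dilated ball, so that no doubling of `S` is needed for its boundedness. -/
noncomputable def modifiedMaximal (S : Measure X) (R : ℝ) (g : X → ℝ≥0∞) (x : X) : ℝ≥0∞ :=
  ⨆ r ∈ Ioo (0 : ℝ) R, (S (ball x (8 * r)))⁻¹ * S.withDensity g (ball x r)

variable [BorelSpace X]

theorem measurable_modifiedMaximal (S : Measure X) (R : ℝ) (g : X → ℝ≥0∞) :
    Measurable (modifiedMaximal S R g) := by
  have h := measurable_iSup_inv_measure_ball_mul S (S.withDensity g) (by norm_num : (0 : ℝ) < 8)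
    one_pos R
  simp only [one_mul] at h
  exact h

/-- Where `2g ≤ t`, the function `g` contributes at most half of `t S(B(x,8r))` to its integral over
`B(x,r)`. That half is absorbed, `S` being finite on balls, and Vitali is applied to the part of `g`
above `t/2`. Keeping only large values of `g` on the right is what makes the estimate integrable in
`t`. -/
theorem mul_measure_lt_modifiedMaximal_le [TopologicalSpace.SeparableSpace X] (S : Measure X)
    (hS : ∀ x r, S (ball x r) < ∞) (R : ℝ) (g : X → ℝ≥0∞) (t : ℝ≥0) :
    t * S {x | (t : ℝ≥0∞) < modifiedMaximal S R g x} ≤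
      2 * S.withDensity g {x | (t : ℝ≥0∞) < 2 * g x} := by
  set A : Set X := {x | (t : ℝ≥0∞) < 2 * g x} with hA
  have := measure_le_of_ball_le_ball ((t : ℝ≥0∞) • S)
      ((2 : ℝ≥0∞) • S.withDensity (A.indicator g)) R
      {x | (t : ℝ≥0∞) < modifiedMaximal S R g x} ?_
  · refine this.trans ?_
    simp only [Measure.smul_apply, smul_eq_mul, withDensity_apply _ MeasurableSet.univ,
      Measure.restrict_univ]
    gcongr
    exact (lintegral_indicator_le _ _).trans (withDensity_apply_le _ _)
  intro x hx
  simp only [mem_ofPred_eq, modifiedMaximal, lt_iSup_iff] at hx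
  obtain ⟨r, hr, hlt⟩ := hx
  refine ⟨r, hr, ?_⟩
  simp only [Measure.smul_apply, smul_eq_mul]
  set B := S (ball x (8 * r)) with hB
  have hBfin : B ≠ ∞ := (hS x _).ne
  have h1 : (t : ℝ≥0∞) * B ≤ S.withDensity g (ball x r) := by
    calc (t : ℝ≥0∞) * B ≤ B⁻¹ * S.withDensity g (ball x r) * B := by gcongr
      _ = (B⁻¹ * B) * S.withDensity g (ball x r) := by ring
      _ ≤ 1 * S.withDensity g (ball x r) := by gcongr; exact ENNReal.inv_mul_le_one _
      _ = _ := one_mul _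
  have h2 : 2 * S.withDensity g (ball x r) ≤
      2 * S.withDensity (A.indicator g) (ball x r) + t * B := by
    rw [withDensity_apply _ measurableSet_ball, withDensity_apply _ measurableSet_ball,
      ← lintegral_const_mul' _ _ (by norm_num), ← lintegral_const_mul' _ _ (by norm_num)]
    calc ∫⁻ y in ball x r, 2 * g y ∂S
        ≤ ∫⁻ y in ball x r, (2 * A.indicator g y + t) ∂S := by
          refine lintegral_mono fun y => ?_
          by_cases hy : y ∈ A
          · simp [hy]
          · rw [indicator_of_notMem hy, mul_zero, zero_add]
            exact not_lt.1 hy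
      _ = ∫⁻ y in ball x r, 2 * A.indicator g y ∂S + t * S (ball x r) := by
          rw [lintegral_add_right _ measurable_const, setLIntegral_const]
      _ ≤ _ := by
          have : ball x r ⊆ ball x (8 * r) := ball_subset_ball (by linarith [hr.1])
          rw [hB]
          gcongr
  have h3 : (t : ℝ≥0∞) * B + t * B ≤ 2 * S.withDensity (A.indicator g) (ball x r) + t * B := by
    rw [← two_mul]
    exact (by gcongr : 2 * ((t : ℝ≥0∞) * B) ≤ 2 * S.withDensity g (ball x r)).trans h2
  exact (ENNReal.add_le_add_iff_right (ENNReal.mul_ne_top ENNReal.coe_ne_top hBfin)).1 h3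

/-- The modified maximal function is bounded on `L^p(S)` for `1 < p`. -/
theorem lintegral_modifiedMaximal_rpow_le [TopologicalSpace.SeparableSpace X] (S : Measure X)
    (hS : ∀ x r, S (ball x r) < ∞) (R : ℝ) {p : ℝ} (hp : 1 < p) :
    ∃ C : ℝ≥0∞, C ≠ ∞ ∧ ∀ g : X → ℝ≥0, AEMeasurable g S →
      ∫⁻ x, modifiedMaximal S R (fun y => g y) x ^ p ∂S ≤ C * ∫⁻ x, (g x : ℝ≥0∞) ^ p ∂S := by
  have hp0 : 0 < p := by linarith
  have hp1 : 0 < p - 1 := by linarith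
  -- Layer cake: `p ∫ t^(p-1) S{T > t} dt ≤ 2p ∫ t^(p-2) (gS){2g > t} dt = (2p/(p-1)) ∫ (2g)^(p-1) g
  -- dS`.
  refine ⟨ENNReal.ofReal p * 2 * (ENNReal.ofReal (p - 1))⁻¹ * 2 ^ (p - 1), ?_, fun g hg => ?_⟩
  · refine ENNReal.mul_ne_top (ENNReal.mul_ne_top (ENNReal.mul_ne_top ENNReal.ofReal_ne_top
      (by norm_num)) (ENNReal.inv_ne_top.2 ?_)) (ENNReal.rpow_ne_top_of_nonneg hp1.le (by norm_num))
    simpa using hp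
  set T := modifiedMaximal S R (fun y => (g y : ℝ≥0∞)) with hT
  have hTm : Measurable T := measurable_modifiedMaximal S R _
  set SG := S.withDensity (fun y => (g y : ℝ≥0∞)) with hSG
  have hgm : AEMeasurable (fun y => (g y : ℝ≥0∞)) S := hg.coe_nnreal_ennreal
  -- The layer cake formula is for real-valued functions and `T` may be infinite; the truncation is
  -- removed by monotone convergence.
  have trunc : ∀ n : ℕ, ∫⁻ x, (min (T x) n) ^ p ∂S ≤
      ENNReal.ofReal p * 2 * (ENNReal.ofReal (p - 1))⁻¹ * 2 ^ (p - 1) *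
        ∫⁻ x, (g x : ℝ≥0∞) ^ p ∂S := by
    intro n
    have hfin : ∀ x, min (T x) n ≠ ∞ := fun x =>
      ((min_le_right _ _).trans_lt (ENNReal.natCast_lt_top n)).ne
    have hTn : Measurable fun x => min (T x) (n : ℝ≥0∞) := Measurable.min hTm measurable_const
    have hleft := lintegral_rpow_eq_lintegral_meas_lt_mul S
      (f := fun x => (min (T x) n).toReal)
      (Filter.Eventually.of_forall fun x => ENNReal.toReal_nonneg)
      hTn.ennreal_toReal.aemeasurable hp0
    have hright := lintegral_rpow_eq_lintegral_meas_lt_mul SG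
      (f := fun x => 2 * (g x : ℝ)) (Filter.Eventually.of_forall fun x => by positivity)
      ((hg.mono_ac (withDensity_absolutelyContinuous _ _)).coe_nnreal_real.const_mul 2) hp1
    calc ∫⁻ x, (min (T x) n) ^ p ∂S
        = ∫⁻ x, ENNReal.ofReal ((min (T x) n).toReal ^ p) ∂S := by
          refine lintegral_congr fun x => ?_
          rw [← ENNReal.ofReal_rpow_of_nonneg ENNReal.toReal_nonneg hp0.le,
            ENNReal.ofReal_toReal (hfin x)]
      _ = ENNReal.ofReal p * ∫⁻ t in Ioi (0 : ℝ), S {x | t < (min (T x) n).toReal} *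
            ENNReal.ofReal (t ^ (p - 1)) := hleft
      _ ≤ ENNReal.ofReal p * ∫⁻ t in Ioi (0 : ℝ), 2 * (SG {x | t < 2 * (g x : ℝ)} *
            ENNReal.ofReal (t ^ (p - 1 - 1))) := by
          refine mul_le_mul_right ?_ _
          refine setLIntegral_mono' measurableSet_Ioi fun t ht => ?_
          rw [mem_Ioi] at ht
          have hw := mul_measure_lt_modifiedMaximal_le S hS R (fun y => (g y : ℝ≥0∞)) t.toNNReal
          have h1 : {x | t < (min (T x) n).toReal} ⊆ {x | ((t.toNNReal : ℝ≥0) : ℝ≥0∞) < T x} := by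
            intro x hx
            have : ENNReal.ofReal t < min (T x) n :=
              (ENNReal.ofReal_lt_iff_lt_toReal ht.le (hfin x)).2 hx
            exact this.trans_le (min_le_left _ _)
          have h2 : {x | t < 2 * (g x : ℝ)} =
              {x | ((t.toNNReal : ℝ≥0) : ℝ≥0∞) < 2 * (g x : ℝ≥0∞)} := by
            ext x
            have : (2 * (g x : ℝ≥0∞)) = ((2 * g x : ℝ≥0) : ℝ≥0∞) := by push_cast; rfl
            rw [mem_ofPred_eq, mem_ofPred_eq, this, ENNReal.coe_lt_coe,
              Real.toNNReal_lt_iff_lt_coe ht.le]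
            push_cast; rfl
          rw [h2]
          have h3 : ENNReal.ofReal (t ^ (p - 1)) =
              (t.toNNReal : ℝ≥0∞) * ENNReal.ofReal (t ^ (p - 1 - 1)) := by
            rw [Real.rpow_sub_one ht.ne' (p - 1), ← ENNReal.ofReal, ← ENNReal.ofReal_mul ht.le,
              mul_div_cancel₀ _ ht.ne']
          rw [h3]
          calc _ = (t.toNNReal * S {x | t < (min (T x) n).toReal}) *
                ENNReal.ofReal (t ^ (p - 1 - 1)) := by ring
            _ ≤ (t.toNNReal * S {x | ((t.toNNReal : ℝ≥0) : ℝ≥0∞) < T x}) *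
                ENNReal.ofReal (t ^ (p - 1 - 1)) := by gcongr
            _ ≤ _ := by rw [← mul_assoc]; gcongr
      _ = ENNReal.ofReal p * 2 * (ENNReal.ofReal (p - 1))⁻¹ * (ENNReal.ofReal (p - 1) *
            ∫⁻ t in Ioi (0 : ℝ), SG {x | t < 2 * (g x : ℝ)} * ENNReal.ofReal (t ^ (p - 1 - 1))) := by
          rw [lintegral_const_mul' _ _ (by norm_num)]
          have : (ENNReal.ofReal (p - 1))⁻¹ * ENNReal.ofReal (p - 1) = 1 :=
            ENNReal.inv_mul_cancel (by simpa using hp) ENNReal.ofReal_ne_top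
          rw [mul_assoc _ (ENNReal.ofReal (p - 1))⁻¹, ← mul_assoc (ENNReal.ofReal (p - 1))⁻¹, this,
            one_mul, mul_assoc]
      _ = ENNReal.ofReal p * 2 * (ENNReal.ofReal (p - 1))⁻¹ *
            ∫⁻ x, ENNReal.ofReal ((2 * (g x : ℝ)) ^ (p - 1)) ∂SG := by rw [hright]
      _ = ENNReal.ofReal p * 2 * (ENNReal.ofReal (p - 1))⁻¹ *
            ∫⁻ x, 2 ^ (p - 1) * (g x : ℝ≥0∞) ^ p ∂S := by
          congr 1
          rw [hSG, lintegral_withDensity_eq_lintegral_mul_non_measurable₀ _ hgm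
            (Filter.Eventually.of_forall fun x => ENNReal.coe_lt_top)]
          refine lintegral_congr fun x => ?_
          rw [Pi.mul_apply, ← ENNReal.ofReal_rpow_of_nonneg (by positivity) hp1.le,
            ENNReal.ofReal_mul (by norm_num), ENNReal.ofReal_coe_nnreal,
            ENNReal.mul_rpow_of_nonneg _ _ hp1.le]
          have : (g x : ℝ≥0∞) ^ p = g x * (g x : ℝ≥0∞) ^ (p - 1) := by
            conv_lhs => rw [show p = 1 + (p - 1) by ring]
            rw [ENNReal.rpow_add_of_nonneg _ _ zero_le_one hp1.le, ENNReal.rpow_one]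
          rw [this]
          norm_num
          ring
      _ = _ := by
          rw [lintegral_const_mul' _ _ (ENNReal.rpow_ne_top_of_nonneg hp1.le (by norm_num)),
            ← mul_assoc]
  have hsup : ∀ x, T x ^ p = ⨆ n : ℕ, (min (T x) n) ^ p := by
    intro x
    have hinf : T x = ⨆ n : ℕ, min (T x) n := by
      rw [← inf_iSup_eq, ENNReal.iSup_natCast, inf_top_eq]
    conv_lhs => rw [hinf]
    exact (ENNReal.monotone_rpow_of_nonneg hp0.le).map_iSup_of_continuousAt
      ENNReal.continuous_rpow_const.continuousAt (by simp [hp0])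
  simp_rw [hsup]
  rw [lintegral_iSup (fun n => (Measurable.min hTm measurable_const).pow_const p)]
  · exact iSup_le trunc
  · intro m n hmn x
    dsimp only
    gcongr

end StrongType

/-! ### Construction of the weight `u` -/

section Weights

theorem eLpNorm_ofReal_eq {X E : Type*} [MeasurableSpace X] [ENorm E] {p : ℝ} (hp : 0 < p)
    (F : X → E) (ν : Measure X) :
    eLpNorm F (ENNReal.ofReal p) ν = (∫⁻ x, ‖F x‖ₑ ^ p ∂ν) ^ (1 / p) := by
  rw [eLpNorm_eq_lintegral_rpow_enorm_toReal (by simpa using hp) ENNReal.ofReal_ne_top,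
    ENNReal.toReal_ofReal hp.le]

theorem holderConjugate_ofReal_eq {p : ℝ} (hp : 1 < p) {p' : ℝ≥0∞}
    (h : ENNReal.HolderConjugate (ENNReal.ofReal p) p') : p' = ENNReal.ofReal (p / (p - 1)) := by
  have hp1 : 0 < p - 1 := by linarith
  have := ENNReal.HolderConjugate.conj_eq (p := ENNReal.ofReal p) (q := p')
  rw [this, ← ENNReal.ofReal_one, ← ENNReal.ofReal_sub _ zero_le_one,
    ← ENNReal.ofReal_inv_of_pos hp1, ← ENNReal.ofReal_add zero_le_one (by positivity)]
  congr 1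
  field_simp
  ring

theorem holderConjugate_one_eq {p' : ℝ≥0∞}
    (h : ENNReal.HolderConjugate (ENNReal.ofReal 1) p') : p' = ∞ := by
  have := ENNReal.HolderConjugate.conj_eq (p := ENNReal.ofReal 1) (q := p')
  simpa using this

variable {X : Type*} [MeasurableSpace X]

/-- For `1 < p`, local `p'`-integrability of `v ^ (-1/p)` is local integrability of the dual weight
`v ^ (-1/(p-1))`. -/
theorem memLp_indicator_rpow_iff (μ : Measure X) {v : X → ℝ} (hvm : Measurable v)
    (hv : ∀ x, 0 < v x) {p : ℝ} (hp : 1 < p) {p' : ℝ≥0∞}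
    (h : ENNReal.HolderConjugate (ENNReal.ofReal p) p') {B : Set X} (hB : MeasurableSet B) :
    MemLp (B.indicator fun x => v x ^ (-(1 / p))) p' μ ↔
      ∫⁻ x in B, ENNReal.ofReal (v x ^ (-(1 / (p - 1)))) ∂μ < ∞ := by
  have hp1 : 0 < p - 1 := by linarith
  have hq : 0 < p / (p - 1) := by positivity
  rw [memLp_indicator_iff_restrict hB, holderConjugate_ofReal_eq hp h, MemLp,
    and_iff_right (hvm.pow_const _).aestronglyMeasurable,
    eLpNorm_lt_top_iff_lintegral_rpow_enorm_lt_top (by simpa using hq) ENNReal.ofReal_ne_top,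
    ENNReal.toReal_ofReal hq.le]
  congr! 3 with x
  rw [Real.enorm_eq_ofReal (Real.rpow_nonneg (hv x).le _),
    ENNReal.ofReal_rpow_of_nonneg (Real.rpow_nonneg (hv x).le _) hq.le, ← Real.rpow_mul (hv x).le]
  congr 2
  field_simp

theorem weighted_absolutelyContinuous' (μ : Measure X) {v : X → ℝ} (hvm : Measurable v)
    (hv : ∀ x, 0 < v x) : μ ≪ weighted μ v :=
  withDensity_absolutelyContinuous' hvm.ennreal_ofReal.aemeasurable
    (Filter.Eventually.of_forall fun x => by simpa using hv x)

theorem lintegral_weighted (μ : Measure X) {v : X → ℝ} (hvm : Measurable v) (g : X → ℝ≥0∞) :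
    ∫⁻ x, g x ∂(weighted μ v) = ∫⁻ x, ENNReal.ofReal (v x) * g x ∂μ :=
  lintegral_withDensity_eq_lintegral_mul_non_measurable _ hvm.ennreal_ofReal
    (Filter.Eventually.of_forall fun _ => ENNReal.ofReal_lt_top) _

variable [MetricSpace X] [BorelSpace X]

theorem isWeight_of_le_one [TopologicalSpace.SeparableSpace X] [LocallyCompactSpace X]
    (μ : Measure X) [IsLocallyFiniteMeasure μ] {u : X → ℝ} (hm : Measurable u)
    (hpos : ∀ x, 0 < u x) (hle : ∀ x, u x ≤ 1) : IsWeight μ u := by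
  refine ⟨hm, hpos, ?_⟩
  have : SecondCountableTopology X := UniformSpace.secondCountable_of_separable X
  have h : weighted μ u ≤ μ := by
    have : weighted μ u ≤ μ.withDensity 1 :=
      withDensity_mono (Filter.Eventually.of_forall fun x => by simpa using hle x)
    simpa using this
  have : IsLocallyFiniteMeasure (weighted μ u) := Measure.isLocallyFiniteMeasure_of_le h
  infer_instance

theorem localMaximal_le_mul_modifiedMaximal (μ S : Measure X) (R : ℝ) (f : X → ℝ) (g : X → ℝ≥0∞)
    (hS : ∀ x r, S (ball x r) < ∞) (hfg : S.withDensity g = μ.withDensity fun y => ‖f y‖ₑ) (x : X) :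
    localMaximal μ R f x ≤
      (⨆ r ∈ Ioo (0 : ℝ) R, (μ (ball x r))⁻¹ * S (ball x (8 * r))) * modifiedMaximal S R g x := by
  refine iSup₂_le fun r hr => ?_
  have h1 := le_iSup₂ (f := fun (r : ℝ) (_ : r ∈ Ioo (0 : ℝ) R) =>
    (μ (ball x r))⁻¹ * S (ball x (8 * r))) r hr
  have h2 : (S (ball x (8 * r)))⁻¹ * S.withDensity g (ball x r) ≤ modifiedMaximal S R g x :=
    le_iSup₂ (f := fun (r : ℝ) (_ : r ∈ Ioo (0 : ℝ) R) =>
      (S (ball x (8 * r)))⁻¹ * S.withDensity g (ball x r)) r hr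
  refine le_trans ?_ (mul_le_mul' h1 h2)
  rw [averaging, ← withDensity_apply _ measurableSet_ball, ← hfg]
  -- The two factors `S(B(x,8r))` cancel unless they vanish, in which case the integral over
  -- `B(x,r)` vanishes too.
  by_cases h0 : S (ball x (8 * r)) = 0
  · have : S (ball x r) = 0 := measure_mono_null (ball_subset_ball (by linarith [hr.1])) h0
    rw [withDensity_absolutelyContinuous S g this, mul_zero]
    exact zero_le
  · have : S (ball x (8 * r)) * (S (ball x (8 * r)))⁻¹ = 1 :=
      ENNReal.mul_inv_cancel h0 (hS x _).ne
    rw [mul_assoc, ← mul_assoc (S (ball x (8 * r))), this, one_mul]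

theorem exists_weight_strong_type [TopologicalSpace.SeparableSpace X]
    [LocallyCompactSpace X] (μ : Measure X) [IsLocallyFiniteMeasure μ]
    (hμ : VolumeDoubling μ) (o : X) {p : ℝ} (hp : 1 < p) {v : X → ℝ} (hvm : Measurable v)
    (hv : ∀ x, 0 < v x)
    (hloc : ∀ r : ℝ, ∫⁻ x in ball o r, ENNReal.ofReal (v x ^ (-(1 / (p - 1)))) ∂μ < ∞) (R : ℝ) :
    ∃ u : X → ℝ, IsWeight μ u ∧
      BoundedIntoLp (localMaximal μ R) p (weighted μ v) (weighted μ u) := by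
  have hp0 : 0 < p := by linarith
  have hp1 : 0 < p - 1 := by linarith
  set σ : X → ℝ := fun x => v x ^ (-(1 / (p - 1))) with hσ
  have hσm : Measurable σ := hvm.pow_const _
  have hσpos : ∀ x, 0 < σ x := fun x => Real.rpow_pos_of_pos (hv x) _
  set S := weighted μ σ with hSdef
  have hSo : ∀ r, S (ball o r) < ∞ := fun r => by
    rw [hSdef, weighted, withDensity_apply _ measurableSet_ball]
    exact hloc r
  have hS : ∀ x r, S (ball x r) < ∞ := fun x r =>
    (measure_mono (ball_subset_ball' le_rfl)).trans_lt (hSo (r + dist x o))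
  set K : X → ℝ≥0∞ := fun x => ⨆ r ∈ Ioo (0 : ℝ) R, (μ (ball x r))⁻¹ * S (ball x (8 * r)) with hK
  have hKm : Measurable K := by
    have h := measurable_iSup_inv_measure_ball_mul μ S one_pos (by norm_num : (0 : ℝ) < 8) R
    simp only [one_mul] at h
    exact h
  have hKfin : ∀ᵐ x ∂μ, K x < ∞ := hμ.ae_iSup_lt_top S o hSo R
  classical
  -- The bound `U ≤ 1` makes `U dμ` a Radon measure; the value `1` on the null set `K = ∞` keeps `U`
  -- positive everywhere.
  set U : X → ℝ≥0∞ := fun x => if K x = ∞ then 1 else min 1 (ENNReal.ofReal (σ x) * (K x ^ p)⁻¹)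
    with hU
  have hUle : ∀ x, U x ≤ 1 := fun x => by
    simp only [hU]
    split_ifs
    · exact le_rfl
    · exact min_le_left _ _
  have hUpos : ∀ x, U x ≠ 0 := fun x => by
    simp only [hU]
    split_ifs with h
    · exact one_ne_zero
    · refine (lt_min one_pos (ENNReal.mul_pos (by simpa using hσpos x)
        (ENNReal.inv_ne_zero.2 (ENNReal.rpow_ne_top_of_nonneg hp0.le h)))).ne'
  have hUtop : ∀ x, U x ≠ ∞ := fun x => ((hUle x).trans_lt ENNReal.one_lt_top).ne
  have hUm : Measurable U := Measurable.ite (hKm (measurableSet_singleton ∞)) measurable_const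
    (measurable_const.min (hσm.ennreal_ofReal.mul (hKm.pow_const p).inv))
  have hu : IsWeight μ fun x => (U x).toReal := isWeight_of_le_one μ hUm.ennreal_toReal
    (fun x => ENNReal.toReal_pos (hUpos x) (hUtop x))
    (fun x => ENNReal.toReal_mono ENNReal.one_ne_top (hUle x))
  refine ⟨_, hu, ?_⟩
  obtain ⟨C, hC, hT⟩ := lintegral_modifiedMaximal_rpow_le S hS R hp
  have key : ∀ f : X → ℝ, AEMeasurable f μ →
      ∫⁻ x, localMaximal μ R f x ^ p ∂(weighted μ fun x => (U x).toReal) ≤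
        C * ∫⁻ x, ‖f x‖ₑ ^ p ∂(weighted μ v) := by
    intro f hf
    set g : X → ℝ≥0 := fun x => ‖f x‖₊ / (σ x).toNNReal with hg
    have hgm : AEMeasurable g μ := hf.nnnorm.div hσm.real_toNNReal.aemeasurable
    have hσg : ∀ x, ENNReal.ofReal (σ x) * g x = ‖f x‖ₑ := fun x => by
      rw [ENNReal.ofReal, ← ENNReal.coe_mul, hg]
      dsimp only
      rw [mul_div_cancel₀ _ (by simpa using hσpos x), enorm_eq_nnnorm]
    have hfg : S.withDensity (fun y => (g y : ℝ≥0∞)) = μ.withDensity fun y => ‖f y‖ₑ := by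
      rw [hSdef, weighted, ← withDensity_mul₀ hσm.ennreal_ofReal.aemeasurable
        hgm.coe_nnreal_ennreal]
      exact congrArg _ (funext hσg)
    have hM := localMaximal_le_mul_modifiedMaximal μ S R f _ hS hfg
    rw [lintegral_weighted _ hu.measurable]
    calc ∫⁻ x, ENNReal.ofReal (U x).toReal * localMaximal μ R f x ^ p ∂μ
        ≤ ∫⁻ x, ENNReal.ofReal (σ x) * modifiedMaximal S R (fun y => g y) x ^ p ∂μ := by
          refine lintegral_mono_ae ?_
          filter_upwards [hKfin] with x hx
          rw [ENNReal.ofReal_toReal (hUtop x)]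
          have hUx : U x ≤ ENNReal.ofReal (σ x) * (K x ^ p)⁻¹ := by
            simp only [hU, if_neg hx.ne]
            exact min_le_right _ _
          calc U x * localMaximal μ R f x ^ p
              ≤ (ENNReal.ofReal (σ x) * (K x ^ p)⁻¹) *
                  (K x * modifiedMaximal S R (fun y => g y) x) ^ p := by
                gcongr
                exact hM x
            _ = ENNReal.ofReal (σ x) * ((K x ^ p)⁻¹ * K x ^ p) *
                  modifiedMaximal S R (fun y => g y) x ^ p := by
                rw [ENNReal.mul_rpow_of_nonneg _ _ hp0.le]
                ring
            _ ≤ ENNReal.ofReal (σ x) * 1 * modifiedMaximal S R (fun y => g y) x ^ p := by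
                gcongr
                exact ENNReal.inv_mul_le_one _
            _ = _ := by rw [mul_one]
      _ = ∫⁻ x, modifiedMaximal S R (fun y => g y) x ^ p ∂S := (lintegral_weighted _ hσm _).symm
      _ ≤ C * ∫⁻ x, (g x : ℝ≥0∞) ^ p ∂S :=
          hT g (hgm.mono_ac (withDensity_absolutelyContinuous _ _))
      _ = C * ∫⁻ x, ‖f x‖ₑ ^ p ∂(weighted μ v) := by
          rw [lintegral_weighted _ hvm, hSdef, lintegral_weighted _ hσm]
          congr 1
          refine lintegral_congr fun x => ?_
          have h1 : ENNReal.ofReal (v x) * ENNReal.ofReal (σ x) ^ p = ENNReal.ofReal (σ x) := by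
            rw [ENNReal.ofReal_rpow_of_pos (hσpos x), ← ENNReal.ofReal_mul (hv x).le]
            congr 1
            simp only [hσ]
            rw [← Real.rpow_mul (hv x).le]
            nth_rewrite 1 [← Real.rpow_one (v x)]
            rw [← Real.rpow_add (hv x)]
            congr 1
            field_simp
            ring
          rw [← hσg x, ENNReal.mul_rpow_of_nonneg _ _ hp0.le, ← mul_assoc, h1]
  refine ⟨(C ^ (1 / p)).toNNReal, fun f hf => ?_⟩
  have hfm : AEMeasurable f μ := hf.1.aemeasurable.mono_ac (weighted_absolutelyContinuous' μ hvm hv)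
  have hbd : eLpNorm (localMaximal μ R f) (ENNReal.ofReal p) (weighted μ fun x => (U x).toReal) ≤
      (C ^ (1 / p)).toNNReal * eLpNorm f (ENNReal.ofReal p) (weighted μ v) := by
    rw [ENNReal.coe_toNNReal (ENNReal.rpow_ne_top_of_nonneg (by positivity) hC),
      eLpNorm_ofReal_eq hp0, eLpNorm_ofReal_eq hp0,
      ← ENNReal.mul_rpow_of_nonneg _ _ (by positivity)]
    gcongr
    exact key f hfm
  exact ⟨⟨(measurable_localMaximal μ R f).aestronglyMeasurable,
    hbd.trans_lt (ENNReal.mul_lt_top ENNReal.coe_lt_top hf.2)⟩, hbd⟩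

theorem exists_weight_weak_type [TopologicalSpace.SeparableSpace X]
    [LocallyCompactSpace X] (μ : Measure X) [IsLocallyFiniteMeasure μ]
    (hμ : VolumeDoubling μ) (o : X) {v : X → ℝ} (hvm : Measurable v) (hv : ∀ x, 0 < v x)
    (hloc : MemLpLoc μ o ∞ fun x => (v x)⁻¹) {R : ℝ} (hR : 0 < R) :
    ∃ u : X → ℝ, IsWeight μ u ∧
      BoundedIntoWeakLp (localMaximal μ R) 1 (weighted μ v) (weighted μ u) := by
  obtain ⟨C, hC⟩ := hμ.pow
  set Φ : ℝ → ℝ≥0∞ := fun s => eLpNorm ((ball o s).indicator fun x => (v x)⁻¹) ∞ μ with hΦ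
  have hΦmono : Monotone Φ := fun s t hst => eLpNorm_mono fun x =>
    norm_indicator_le_of_subset (ball_subset_ball hst) _ _
  -- If `y ∈ B(x, 8r)` with `r < R`, then `B(x, r) ⊆ B(o, d(y,o) + 9R)`. So `U ≤ m⁻¹` on the
  -- enlarged ball, `m` being the essential supremum of `v⁻¹` on `B(x, r)`.
  set U : X → ℝ≥0∞ := fun y => (max 1 (Φ (dist y o + 9 * R)))⁻¹ with hU
  have hUm : Measurable U := by
    have h1 : Measurable Φ := hΦmono.measurable
    have h2 : Measurable fun y : X => dist y o + 9 * R := (by fun_prop : Continuous _).measurable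
    exact (measurable_const.max (h1.comp h2)).inv
  have hUle : ∀ x, U x ≤ 1 := fun x => ENNReal.inv_le_one.2 (le_max_left _ _)
  have hUtop : ∀ x, U x ≠ ∞ := fun x => ((hUle x).trans_lt ENNReal.one_lt_top).ne
  have hUpos : ∀ x, U x ≠ 0 := fun x => ENNReal.inv_ne_zero.2
    (max_lt ENNReal.one_lt_top (hloc _ (by positivity)).2).ne
  have hu : IsWeight μ fun x => (U x).toReal := isWeight_of_le_one μ hUm.ennreal_toReal
    (fun x => ENNReal.toReal_pos (hUpos x) (hUtop x))
    (fun x => ENNReal.toReal_mono ENNReal.one_ne_top (hUle x))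
  refine ⟨_, hu, C ^ 3, fun f hf => ?_⟩
  have hbd : weakNorm (localMaximal μ R f) 1 (weighted μ fun x => (U x).toReal) ≤
      (C ^ 3 : ℝ≥0) * eLpNorm f (ENNReal.ofReal 1) (weighted μ v) := by
    refine iSup₂_le fun t ht => ?_
    rw [div_one, ENNReal.rpow_one, ENNReal.ofReal_one, eLpNorm_one_eq_lintegral_enorm]
    have := measure_le_of_ball_le_ball ((t : ℝ≥0∞) • weighted μ fun x => (U x).toReal)
      (((C ^ 3 : ℝ≥0) : ℝ≥0∞) • (weighted μ v).withDensity fun y => ‖f y‖ₑ) R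
      {x | (t : ℝ≥0∞) < localMaximal μ R f x} ?_
    · simpa using this
    intro x hx
    simp only [mem_ofPred_eq, localMaximal, lt_iSup_iff] at hx
    obtain ⟨r, hr, hlt⟩ := hx
    refine ⟨r, hr, ?_⟩
    set m : ℝ≥0∞ := eLpNorm ((ball x r).indicator fun x => (v x)⁻¹) ∞ μ with hm
    have hUmle : ∀ y ∈ ball x (8 * r), U y ≤ m⁻¹ := fun y hy => by
      refine ENNReal.inv_le_inv.2 (le_trans ?_ (le_max_right _ _))
      refine eLpNorm_mono fun z => norm_indicator_le_of_subset (ball_subset_ball' ?_) _ _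
      have := dist_triangle x y o
      rw [mem_ball, dist_comm] at hy
      linarith [hr.2]
    have h1 : weighted μ (fun x => (U x).toReal) (ball x (8 * r)) ≤
        m⁻¹ * μ (ball x (8 * r)) := by
      rw [weighted, withDensity_apply _ measurableSet_ball, ← setLIntegral_const]
      exact setLIntegral_mono' measurableSet_ball fun y hy => by
        rw [ENNReal.ofReal_toReal (hUtop y)]
        exact hUmle y hy
    have h2 : ∫⁻ y in ball x r, ‖f y‖ₑ ∂μ ≤
        m * (weighted μ v).withDensity (fun y => ‖f y‖ₑ) (ball x r) := by
      rw [withDensity_apply _ measurableSet_ball, weighted,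
        setLIntegral_withDensity_eq_setLIntegral_mul_non_measurable _ hvm.ennreal_ofReal _
          measurableSet_ball (Filter.Eventually.of_forall fun _ => ENNReal.ofReal_lt_top)]
      have hmtop : m ≠ ∞ := by
        refine (lt_of_le_of_lt (eLpNorm_mono fun z => norm_indicator_le_of_subset
          (ball_subset_ball' ?_) _ _) (hloc (dist x o + R) (by positivity)).2).ne
        linarith [hr.2]
      rw [← lintegral_const_mul' _ _ hmtop]
      refine lintegral_mono_ae ?_
      have hae : ∀ᵐ y ∂μ, ‖(ball x r).indicator (fun x => (v x)⁻¹) y‖ₑ ≤ m := by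
        rw [hm, eLpNorm_exponent_top]
        exact ae_le_eLpNormEssSup
      rw [ae_restrict_iff' measurableSet_ball]
      filter_upwards [hae] with y hy hyB
      rw [indicator_of_mem hyB, Real.enorm_eq_ofReal (inv_nonneg.2 (hv y).le)] at hy
      rw [Pi.mul_apply, ← mul_assoc]
      have : 1 ≤ m * ENNReal.ofReal (v y) := by
        calc (1 : ℝ≥0∞) = ENNReal.ofReal (v y)⁻¹ * ENNReal.ofReal (v y) := by
              rw [← ENNReal.ofReal_mul (inv_nonneg.2 (hv y).le), inv_mul_cancel₀ (hv y).ne',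
                ENNReal.ofReal_one]
          _ ≤ _ := by gcongr
      calc ‖f y‖ₑ = 1 * ‖f y‖ₑ := (one_mul _).symm
        _ ≤ _ := by gcongr
    simp only [Measure.smul_apply, smul_eq_mul]
    set N := (weighted μ v).withDensity (fun y => ‖f y‖ₑ) (ball x r)
    calc (t : ℝ≥0∞) * weighted μ (fun x => (U x).toReal) (ball x (8 * r))
        ≤ averaging μ r f x * (m⁻¹ * μ (ball x (8 * r))) := by gcongr
      _ ≤ ((μ (ball x r))⁻¹ * (m * N)) * (m⁻¹ * ((C : ℝ≥0∞) ^ 3 * μ (ball x r))) := by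
          rw [averaging]
          gcongr
          have := hC 3 x r hr.1
          norm_num at this
          exact this
      _ = ((μ (ball x r))⁻¹ * μ (ball x r)) * (m * m⁻¹) * ((C : ℝ≥0∞) ^ 3 * N) := by ring
      _ ≤ 1 * 1 * ((C : ℝ≥0∞) ^ 3 * N) := by
          gcongr
          · exact ENNReal.inv_mul_le_one _
          · exact ENNReal.mul_inv_le_one _
      _ = _ := by push_cast; ring
  exact ⟨⟨(measurable_localMaximal μ R f).aemeasurable,
    hbd.trans_lt (ENNReal.mul_lt_top ENNReal.coe_lt_top hf.2)⟩, hbd⟩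

end Weights

/-! ### Necessity: failure of the integrability condition -/

section Necessity

variable {X : Type*} [MeasurableSpace X]

/-- Gliding hump: if the mass of functions of arbitrarily small weighted `p`-energy is unbounded,
then some function of finite weighted energy has infinite mass. -/
theorem exists_lintegral_eq_top_of_forall (ν : Measure X) {p : ℝ} (hp : 0 < p) {w : X → ℝ≥0∞}
    (hw : Measurable w)
    (h : ∀ (n : ℕ) (ε : ℝ≥0∞), ε ≠ 0 → ∃ f : X → ℝ≥0∞, Measurable f ∧ n ≤ ∫⁻ x, f x ∂ν ∧
      ∫⁻ x, w x * f x ^ p ∂ν ≤ ε) :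
    ∃ f : X → ℝ≥0∞, Measurable f ∧ ∫⁻ x, f x ∂ν = ∞ ∧ ∫⁻ x, w x * f x ^ p ∂ν < ∞ := by
  -- The supremum of the humps has mass at least every `n`, and its `p`-th power is at most the sum
  -- of theirs, so the energies add up to at most `∑ 2^(-n-1) = 1`.
  choose f hfm hfn hfe using fun n : ℕ => h n ((2⁻¹ : ℝ≥0∞) ^ (n + 1)) (by simp)
  refine ⟨fun x => ⨆ n, f n x, Measurable.iSup hfm, ?_, ?_⟩
  · refine ENNReal.eq_top_of_forall_nnreal_le fun r => ?_
    obtain ⟨n, hn⟩ := exists_nat_ge r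
    calc (r : ℝ≥0∞) ≤ n := by exact_mod_cast hn
      _ ≤ ∫⁻ x, f n x ∂ν := hfn n
      _ ≤ _ := lintegral_mono fun x => le_iSup (fun n => f n x) n
  · calc ∫⁻ x, w x * (⨆ n, f n x) ^ p ∂ν ≤ ∫⁻ x, ∑' n, w x * f n x ^ p ∂ν := by
          refine lintegral_mono fun x => ?_
          dsimp only
          rw [(ENNReal.monotone_rpow_of_nonneg hp.le).map_iSup_of_continuousAt
            ENNReal.continuous_rpow_const.continuousAt (by simp [hp]), ENNReal.mul_iSup]
          exact iSup_le fun n => ENNReal.le_tsum (f := fun n => w x * f n x ^ p) n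
      _ = ∑' n, ∫⁻ x, w x * f n x ^ p ∂ν :=
          lintegral_tsum fun n => (hw.mul ((hfm n).pow_const p)).aemeasurable
      _ ≤ ∑' n : ℕ, (2⁻¹ : ℝ≥0∞) ^ (n + 1) := ENNReal.tsum_le_tsum hfe
      _ = 1 := by
          rw [ENNReal.tsum_geometric_add_one, ENNReal.one_sub_inv_two, inv_inv,
            ENNReal.inv_mul_cancel two_ne_zero ENNReal.ofNat_ne_top]
      _ < ∞ := ENNReal.one_lt_top

/-- The extremal of Hölder's inequality is `σ`, with `v σ^(p-1) = 1`. Hence `min(σ, k)` has energy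
at most its mass `N`. Rescaled to mass `n`, it has energy at most `n^p / N^(p-1)`, which is small
because `N → ∞` with `k`. -/
theorem exists_large_mass_small_energy (ν : Measure X) [IsFiniteMeasure ν] {p : ℝ} (hp : 1 < p)
    {v : X → ℝ} (hvm : Measurable v) (hv : ∀ x, 0 < v x)
    (h : ∫⁻ x, ENNReal.ofReal (v x ^ (-(1 / (p - 1)))) ∂ν = ∞) (n : ℕ) (ε : ℝ≥0∞) (hε : ε ≠ 0) :
    ∃ f : X → ℝ≥0∞, Measurable f ∧ n ≤ ∫⁻ x, f x ∂ν ∧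
      ∫⁻ x, ENNReal.ofReal (v x) * f x ^ p ∂ν ≤ ε := by
  have hp0 : 0 < p := by linarith
  have hp1 : 0 < p - 1 := by linarith
  set σ : X → ℝ≥0∞ := fun x => ENNReal.ofReal (v x ^ (-(1 / (p - 1)))) with hσ
  have hσm : Measurable σ := (hvm.pow_const _).ennreal_ofReal
  have hvσ : ∀ x, ENNReal.ofReal (v x) * σ x ^ (p - 1) = 1 := fun x => by
    simp only [hσ]
    rw [ENNReal.ofReal_rpow_of_pos (Real.rpow_pos_of_pos (hv x) _), ← ENNReal.ofReal_mul (hv x).le,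
      ← Real.rpow_mul (hv x).le]
    have : -(1 / (p - 1)) * (p - 1) = -1 := by field_simp
    rw [this, Real.rpow_neg_one, mul_inv_cancel₀ (hv x).ne', ENNReal.ofReal_one]
  have hsup : ⨆ k : ℕ, ∫⁻ x, min (σ x) k ∂ν = ∞ := by
    rw [← lintegral_iSup (fun k => Measurable.min hσm measurable_const), ← h]
    · refine lintegral_congr fun x => ?_
      rw [← inf_iSup_eq, ENNReal.iSup_natCast, inf_top_eq]
    · intro m k hmk x
      dsimp only
      gcongr
  -- The second entry gives `N^(p-1) ≥ n^p / ε`; the entry `1` keeps `N` nonzero.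
  obtain ⟨k, hk⟩ : ∃ k : ℕ, max 1 (((n : ℝ≥0∞) ^ p * ε⁻¹) ^ (1 / (p - 1))) <
      ∫⁻ x, min (σ x) k ∂ν := by
    rw [← lt_iSup_iff, hsup]
    refine max_lt ENNReal.one_lt_top (lt_top_iff_ne_top.2 ?_)
    refine ENNReal.rpow_ne_top_of_nonneg (by positivity) (ENNReal.mul_ne_top ?_
      (ENNReal.inv_ne_top.2 hε))
    exact ENNReal.rpow_ne_top_of_nonneg hp0.le (ENNReal.natCast_ne_top n)
  set N := ∫⁻ x, min (σ x) k ∂ν with hN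
  have hN0 : N ≠ 0 := (one_pos.trans ((le_max_left _ _).trans_lt hk)).ne'
  have hNtop : N ≠ ∞ := by
    refine ((lintegral_mono fun x => min_le_right (σ x) (k : ℝ≥0∞)).trans_lt ?_).ne
    rw [lintegral_const]
    exact ENNReal.mul_lt_top (ENNReal.natCast_lt_top k) (measure_lt_top ν _)
  have hatop : (n : ℝ≥0∞) / N ≠ ∞ := ENNReal.div_ne_top (ENNReal.natCast_ne_top n) hN0
  refine ⟨fun x => n / N * min (σ x) k, (Measurable.min hσm measurable_const).const_mul _, ?_, ?_⟩
  · rw [lintegral_const_mul' _ _ hatop, ← hN, ENNReal.div_mul_cancel hN0 hNtop]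
  · have hpow : ∀ a : ℝ≥0∞, a ^ p = a * a ^ (p - 1) := fun a => by
      conv_lhs => rw [show p = 1 + (p - 1) by ring]
      rw [ENNReal.rpow_add_of_nonneg _ _ zero_le_one hp1.le, ENNReal.rpow_one]
    have hNε : (n : ℝ≥0∞) ^ p * ε⁻¹ ≤ N ^ (p - 1) := by
      have := ENNReal.rpow_le_rpow ((le_max_right _ _).trans hk.le) hp1.le
      rwa [← ENNReal.rpow_mul, one_div_mul_cancel hp1.ne', ENNReal.rpow_one] at this
    have hNp0 : N ^ (p - 1) ≠ 0 := (ENNReal.rpow_pos (pos_iff_ne_zero.2 hN0) hNtop).ne'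
    have hNptop : N ^ (p - 1) ≠ ∞ := ENNReal.rpow_ne_top_of_nonneg hp1.le hNtop
    calc ∫⁻ x, ENNReal.ofReal (v x) * (n / N * min (σ x) k) ^ p ∂ν
        ≤ ∫⁻ x, (n / N) ^ p * min (σ x) k ∂ν := by
          refine lintegral_mono fun x => ?_
          dsimp only
          rw [ENNReal.mul_rpow_of_nonneg _ _ hp0.le, hpow (min _ _)]
          calc ENNReal.ofReal (v x) * ((n / N) ^ p * (min (σ x) k * min (σ x) k ^ (p - 1)))
              ≤ ENNReal.ofReal (v x) * ((n / N) ^ p * (min (σ x) k * σ x ^ (p - 1))) := by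
                gcongr
                exact min_le_left _ _
            _ = (n / N) ^ p * min (σ x) k * (ENNReal.ofReal (v x) * σ x ^ (p - 1)) := by ring
            _ = _ := by rw [hvσ, mul_one]
      _ = (n / N) ^ p * N := by
          rw [lintegral_const_mul' _ _ (ENNReal.rpow_ne_top_of_nonneg hp0.le hatop)]
      _ = n ^ p / N ^ (p - 1) := by
          rw [ENNReal.div_rpow_of_nonneg _ _ hp0.le, hpow N, div_eq_mul_inv, div_eq_mul_inv,
            ENNReal.mul_inv (Or.inl hN0) (Or.inl hNtop)]
          calc (n : ℝ≥0∞) ^ p * (N⁻¹ * (N ^ (p - 1))⁻¹) * N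
              = (n : ℝ≥0∞) ^ p * (N ^ (p - 1))⁻¹ * (N⁻¹ * N) := by ring
            _ = _ := by rw [ENNReal.inv_mul_cancel hN0 hNtop, mul_one]
      _ ≤ ε := by
          refine ENNReal.div_le_of_le_mul ?_
          rcases eq_or_ne ε ∞ with rfl | hεtop
          · rw [ENNReal.top_mul hNp0]
            exact le_top
          · calc (n : ℝ≥0∞) ^ p = ε * ((n : ℝ≥0∞) ^ p * ε⁻¹) := by
                  rw [mul_comm, mul_assoc, ENNReal.inv_mul_cancel hε hεtop, mul_one]
              _ ≤ _ := by gcongr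

theorem exists_large_mass_small_integral (ν : Measure X) [IsFiniteMeasure ν]
    {v : X → ℝ} (hvm : Measurable v) (hv : ∀ x, 0 < v x)
    (h : eLpNorm (fun x => (v x)⁻¹) ∞ ν = ∞) (n : ℕ) (ε : ℝ≥0∞) (hε : ε ≠ 0) :
    ∃ f : X → ℝ≥0∞, Measurable f ∧ n ≤ ∫⁻ x, f x ∂ν ∧
      ∫⁻ x, ENNReal.ofReal (v x) * f x ^ (1 : ℝ) ∂ν ≤ ε := by
  -- On `A` one has `v < 1/k`, so mass `n` spread evenly over `A` costs at most `n/k ≤ ε`.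
  obtain ⟨k, hk⟩ := ENNReal.exists_nat_mul_gt hε (ENNReal.natCast_ne_top n)
  set A : Set X := {x | (v x)⁻¹ > k} with hA
  have hAm : MeasurableSet A := measurableSet_lt measurable_const hvm.inv
  have hA0 : ν A ≠ 0 := by
    intro h0
    have hle : eLpNorm (fun x => (v x)⁻¹) ∞ ν ≤ ENNReal.ofReal k := by
      rw [eLpNorm_exponent_top]
      refine eLpNormEssSup_le_of_ae_bound ?_
      have : ∀ᵐ x ∂ν, x ∉ A := measure_eq_zero_iff_ae_notMem.1 h0
      filter_upwards [this] with x hx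
      rw [Real.norm_of_nonneg (inv_nonneg.2 (hv x).le)]
      exact not_lt.1 hx
    rw [h] at hle
    exact ENNReal.ofReal_ne_top (top_unique hle)
  have hAtop : ν A ≠ ∞ := measure_ne_top ν A
  have hatop : (n : ℝ≥0∞) / ν A ≠ ∞ := ENNReal.div_ne_top (ENNReal.natCast_ne_top n) hA0
  refine ⟨A.indicator fun _ => n / ν A, measurable_const.indicator hAm, ?_, ?_⟩
  · rw [lintegral_indicator_const hAm, ENNReal.div_mul_cancel hA0 hAtop]
  · have hk0 : k ≠ 0 := by
      rintro rfl
      simp at hk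
    have hk0' : (k : ℝ≥0∞) ≠ 0 := by exact_mod_cast hk0
    calc ∫⁻ x, ENNReal.ofReal (v x) * (A.indicator (fun _ => (n : ℝ≥0∞) / ν A) x) ^ (1 : ℝ) ∂ν
        ≤ ∫⁻ x, A.indicator (fun _ => (k : ℝ≥0∞)⁻¹ * (n / ν A)) x ∂ν := by
          refine lintegral_mono fun x => ?_
          dsimp only
          rw [ENNReal.rpow_one]
          by_cases hx : x ∈ A
          · rw [indicator_of_mem hx, indicator_of_mem hx]
            gcongr
            rw [ENNReal.le_inv_iff_mul_le, ← ENNReal.ofReal_natCast, ← ENNReal.ofReal_mul (hv x).le,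
              ENNReal.ofReal_le_one]
            calc v x * k ≤ v x * (v x)⁻¹ := by
                  have := (hv x).le
                  have : (k : ℝ) < (v x)⁻¹ := hx
                  gcongr
              _ = 1 := mul_inv_cancel₀ (hv x).ne'
          · simp [hx]
      _ = (k : ℝ≥0∞)⁻¹ * n := by
          rw [lintegral_indicator_const hAm, mul_assoc, ENNReal.div_mul_cancel hA0 hAtop]
      _ ≤ ε := by
          rw [ENNReal.inv_mul_le_iff hk0' (ENNReal.natCast_ne_top k)]
          exact hk.le

/-- Converse to Hölder's inequality on a set of finite measure. -/
theorem exists_memLp_weighted_lintegral_eq_top (μ : Measure X) {p : ℝ} (hp : 1 ≤ p) {p' : ℝ≥0∞}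
    (hpp' : ENNReal.HolderConjugate (ENNReal.ofReal p) p') {v : X → ℝ} (hvm : Measurable v)
    (hv : ∀ x, 0 < v x) {B : Set X} (hB : MeasurableSet B) (hBfin : μ B < ∞)
    (h : ¬ MemLp (B.indicator fun x => v x ^ (-(1 / p))) p' μ) :
    ∃ f : X → ℝ, MemLp f (ENNReal.ofReal p) (weighted μ v) ∧ ∫⁻ x in B, ‖f x‖ₑ ∂μ = ∞ := by
  have hp0 : 0 < p := by linarith
  have : IsFiniteMeasure (μ.restrict B) := ⟨by simpa using hBfin⟩
  obtain ⟨f, hfm, hf, hfe⟩ := exists_lintegral_eq_top_of_forall (μ.restrict B) hp0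
      hvm.ennreal_ofReal (by
    rcases hp.eq_or_lt with rfl | hp
    · refine exists_large_mass_small_integral (μ.restrict B) hvm hv ?_
      rw [holderConjugate_one_eq hpp', memLp_indicator_iff_restrict hB, MemLp,
        and_iff_right (hvm.pow_const _).aestronglyMeasurable, not_lt, top_le_iff] at h
      simpa only [div_one, Real.rpow_neg_one] using h
    · refine exists_large_mass_small_energy (μ.restrict B) hp hvm hv ?_
      rwa [memLp_indicator_rpow_iff μ hvm hv hp hpp' hB, not_lt, top_le_iff] at h)
  -- Finite energy and `v > 0` force `f < ∞` almost everywhere, so passing to real values keeps the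
  -- infinite mass.
  have hfin : ∀ᵐ x ∂μ.restrict B, f x < ∞ := by
    filter_upwards [ae_lt_top (hvm.ennreal_ofReal.mul (hfm.pow_const p)) hfe.ne] with x hx
    by_contra hfx
    rw [not_lt, top_le_iff] at hfx
    rw [Pi.mul_apply, hfx, ENNReal.top_rpow_of_pos hp0, ENNReal.mul_top (by simpa using hv x)] at hx
    exact lt_irrefl _ hx
  refine ⟨B.indicator fun x => (f x).toReal,
    ⟨(hfm.ennreal_toReal.indicator hB).aestronglyMeasurable, ?_⟩, ?_⟩
  · rw [eLpNorm_ofReal_eq hp0]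
    refine ENNReal.rpow_lt_top_of_nonneg (by positivity) (ne_of_lt (lt_of_le_of_lt ?_ hfe))
    rw [lintegral_weighted μ hvm, ← lintegral_indicator hB]
    refine lintegral_mono fun x => ?_
    dsimp only
    by_cases hx : x ∈ B
    · rw [indicator_of_mem hx, indicator_of_mem hx, Real.enorm_eq_ofReal ENNReal.toReal_nonneg]
      gcongr
      exact ENNReal.ofReal_toReal_le
    · simp [hx, hp0]
  · rw [← hf]
    refine lintegral_congr_ae ?_
    filter_upwards [hfin, ae_restrict_mem hB] with x hx hxB
    rw [indicator_of_mem hxB, Real.enorm_eq_ofReal ENNReal.toReal_nonneg,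
      ENNReal.ofReal_toReal hx.ne]

variable [MetricSpace X]

theorem not_memWeakLp_averaging (μ : Measure X) [IsLocallyFiniteMeasure μ] (hμ : VolumeDoubling μ)
    (hμ0 : μ ≠ 0) {R : ℝ} (hR : 0 < R) (z : X) {f : X → ℝ}
    (hf : ∫⁻ x in ball z (R / 2), ‖f x‖ₑ ∂μ = ∞) {p : ℝ} (hp : 0 < p) {u : X → ℝ}
    (hum : Measurable u) (hu : ∀ x, 0 < u x) :
    ¬ MemWeakLp (averaging μ R f) p (weighted μ u) := by
  rintro ⟨-, h⟩
  have hA : ∀ x ∈ ball z (R / 2), averaging μ R f x = ∞ := fun x hx => by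
    have hsub : ball z (R / 2) ⊆ ball x R := by
      apply ball_subset_ball'
      rw [mem_ball, dist_comm] at hx
      linarith
    have : ∫⁻ y in ball x R, ‖f y‖ₑ ∂μ = ∞ := top_unique (hf ▸ lintegral_mono_set hsub)
    rw [averaging, this, ENNReal.mul_top (ENNReal.inv_ne_zero.2 (hμ.measure_ball_lt_top x R).ne)]
  set c := weighted μ u (ball z (R / 2)) with hc
  have hc0 : c ≠ 0 := fun h0 => (hμ.measure_ball_pos hμ0 z (half_pos hR)).ne'
    (weighted_absolutelyContinuous' μ hum hu h0)
  have hcp : c ^ (1 / p) ≠ 0 := by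
    rw [ne_eq, ENNReal.rpow_eq_zero_iff_of_pos (by positivity)]
    exact hc0
  -- Every level set `{A_R f > t}` contains `B(z, R/2)`, so the weak quasinorm is at least `t
  -- c^(1/p)` for every `t`.
  obtain ⟨n, hn⟩ := ENNReal.exists_nat_mul_gt hcp h.ne
  have hn0 : n ≠ 0 := by
    rintro rfl
    simp at hn
  refine hn.not_ge (le_trans ?_ (le_iSup₂ (f := fun (t : ℝ≥0) (_ : 0 < t) => (t : ℝ≥0∞) *
    weighted μ u {x | (t : ℝ≥0∞) < averaging μ R f x} ^ (1 / p)) (n : ℝ≥0)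
    (by positivity)))
  rw [ENNReal.coe_natCast]
  gcongr
  refine measure_mono fun x hx => ?_
  rw [mem_ofPred_eq, hA x hx]
  exact ENNReal.natCast_lt_top n

variable [BorelSpace X]

theorem memLpLoc_of_mapsIntoWeakLp (μ : Measure X) [IsLocallyFiniteMeasure μ]
    (hμ : VolumeDoubling μ) (o : X) {p : ℝ} (hp : 1 ≤ p) {p' : ℝ≥0∞}
    (hpp' : ENNReal.HolderConjugate (ENNReal.ofReal p) p') {v : X → ℝ} (hvm : Measurable v)
    (hv : ∀ x, 0 < v x) {R : ℝ} (hR : 0 < R) {u : X → ℝ} (hum : Measurable u) (hu : ∀ x, 0 < u x)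
    (h : MapsIntoWeakLp (averaging μ R) p (weighted μ v) (weighted μ u)) :
    MemLpLoc μ o p' (fun x => v x ^ (-(1 / p))) := by
  intro r hr
  rcases eq_or_ne μ 0 with rfl | hμ0
  · exact memLp_measure_zero
  have hsmall : ∀ z, MemLp ((ball z (R / 2)).indicator fun x => v x ^ (-(1 / p))) p' μ := by
    intro z
    by_contra hz
    obtain ⟨f, hf, hftop⟩ := exists_memLp_weighted_lintegral_eq_top μ hp hpp' hvm hv
      measurableSet_ball (hμ.measure_ball_lt_top z _) hz
    exact not_memWeakLp_averaging μ hμ hμ0 hR z hftop (by linarith) hum hu (h f hf)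
  obtain ⟨t, ht, hcov⟩ := hμ.exists_finite_cover hμ0 o r (half_pos hR)
  have hsum := memLp_finsetSum (μ := μ) (p := p') ht.toFinset
    (f := fun z => (ball z (R / 2)).indicator fun x => v x ^ (-(1 / p))) fun z _ => hsmall z
  have hnn : ∀ z x, 0 ≤ (ball z (R / 2)).indicator (fun x => v x ^ (-(1 / p))) x := fun z x =>
    indicator_nonneg (fun x _ => Real.rpow_nonneg (hv x).le _) x
  refine hsum.mono ((hvm.pow_const _).indicator measurableSet_ball).aestronglyMeasurable
    (Filter.Eventually.of_forall fun x => ?_)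
  by_cases hx : x ∈ ball o r
  · obtain ⟨z, hz, hxz⟩ := mem_iUnion₂.1 (hcov hx)
    rw [indicator_of_mem hx, Real.norm_of_nonneg (Real.rpow_nonneg (hv x).le _),
      Real.norm_of_nonneg (Finset.sum_nonneg fun z _ => hnn z x)]
    calc v x ^ (-(1 / p)) = (ball z (R / 2)).indicator (fun x => v x ^ (-(1 / p))) x :=
          (indicator_of_mem hxz (fun x => v x ^ (-(1 / p)))).symm
      _ ≤ _ := Finset.single_le_sum
          (f := fun z => (ball z (R / 2)).indicator (fun x => v x ^ (-(1 / p))) x)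
          (fun z _ => hnn z x) (ht.mem_toFinset.2 hz)
  · rw [indicator_of_notMem hx, norm_zero]
    exact norm_nonneg _

end Necessity

end TwoWeight

theorem proposition2p1 {X : Type*} [MetricSpace X] [LocallyCompactSpace X]
    [TopologicalSpace.SeparableSpace X] [MeasurableSpace X] [BorelSpace X]
    (μ : Measure X) [μ.Regular] (hμ : TwoWeight.VolumeDoubling μ) (o : X)
    (p : ℝ) (hp : 1 ≤ p) (p' : ℝ≥0∞) (hpp' : ENNReal.HolderConjugate (ENNReal.ofReal p) p')
    (v : X → ℝ) (hv : TwoWeight.IsWeight μ v) (R : ℝ) (hR : 0 < R) :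
    (TwoWeight.MemLpLoc μ o p' (fun x => v x ^ (-(1 / p))) →
      ∃ u : X → ℝ, TwoWeight.IsWeight μ u ∧
        (1 < p → TwoWeight.BoundedIntoLp (TwoWeight.localMaximal μ R) p
          (TwoWeight.weighted μ v) (TwoWeight.weighted μ u)) ∧
        (p = 1 → TwoWeight.BoundedIntoWeakLp (TwoWeight.localMaximal μ R) 1
          (TwoWeight.weighted μ v) (TwoWeight.weighted μ u))) ∧
    ((∀ r : ℝ, 0 < r → TwoWeight.weighted μ v (ball o r) < ∞) →
      (∃ u : X → ℝ, TwoWeight.IsWeight μ u ∧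
        TwoWeight.MapsIntoWeakLp (TwoWeight.averaging μ R) p
          (TwoWeight.weighted μ v) (TwoWeight.weighted μ u)) →
      TwoWeight.MemLpLoc μ o p' (fun x => v x ^ (-(1 / p)))) := by
  refine ⟨fun h => ?_, fun _ ⟨u, hu, hmap⟩ => TwoWeight.memLpLoc_of_mapsIntoWeakLp μ hμ o hp hpp'
    hv.measurable hv.pos hR hu.measurable hu.pos hmap⟩
  rcases hp.eq_or_lt with rfl | hp
  · rw [TwoWeight.holderConjugate_one_eq hpp'] at h
    simp only [div_one, Real.rpow_neg_one] at h
    obtain ⟨u, hu, hb⟩ := TwoWeight.exists_weight_weak_type μ hμ o hv.measurable hv.pos h hR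
    exact ⟨u, hu, fun h1 => absurd h1 (lt_irrefl _), fun _ => hb⟩
  · have hloc : ∀ r : ℝ, ∫⁻ x in ball o r, ENNReal.ofReal (v x ^ (-(1 / (p - 1)))) ∂μ < ∞ := by
      intro r
      -- `MemLpLoc` concerns positive radii only, hence the radius `max r 1`.
      refine (lintegral_mono_set (ball_subset_ball (le_max_left r 1))).trans_lt ?_
      exact (TwoWeight.memLp_indicator_rpow_iff μ hv.measurable hv.pos hp hpp' measurableSet_ball).1
        (h _ (by positivity))
    obtain ⟨u, hu, hb⟩ := TwoWeight.exists_weight_strong_type μ hμ o hp hv.measurable hv.pos hloc R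
    exact ⟨u, hu, fun _ => hb, fun h1 => absurd h1 hp.ne'⟩
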